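/- For a language $L\subseteq\Sigma^*$ and a word $w\in\Sigma^*$, the quotient of $L$ by $w$ is $w^{-1}L=\{x\in\Sigma^*\mid wx\in L\}$; the quotient complexity of $L$ is the number of its distinct quotients. An atom of a regular language $L$ with (distinct) quotients $K_0,\dots,K_{n-1}$ is a non-empty language of the form $\widetilde{K_0}\cap\cdots\cap\widetilde{K_{n-1}}$, where each $\widetilde{K_i}$ is either $K_i$ or its complement $\overline{K_i}=\Sigma^*\setminus K_i$. For $n\ge 2$ and $1\le r\le n-1$ let $$f(n,r)=1+\sum_{k=1}^{r}\ \sum_{h=k+1}^{k+n-r}\binom{n}{h}\binom{h}{k}.$$ For $n\ge 2$ let $\mathcal D_n$ be the deterministic finite automaton with states $0,\dots,n-1$, alphabet $\{a,b,c\}$, initial state $0$, unique final state $n-1$, and the following transitions: $a$ maps $i$ to $(i+1)\bmod n$; $b$ interchanges $0$ and $1$ and fixes all other states; $c$ maps $n-1$ to $0$ and fixes all other states. Let $L_n$ be the language accepted by $\mathcal D_n$. Theorem. (a) Let $L$ be a regular language with exactly $n$ quotients ($n\ge 1$). Every atom of $L$ with $0$ or $n$ complemented quotients has quotient complexity at most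 $2^n-1$. If $1\le r\le n-1$, every atom of $L$ with $r$ complemented quotients has quotient complexity at most $f(n,r)$. (b) For $n=1$: the languages $\Sigma^*$ and $\emptyset$ have one quotient each, and $\Sigma^*$ is the only atom of each of them (with $0$ complemented quotients for $\Sigma^*$, with $1$ for $\emptyset$); its quotient complexity is $1=2^1-1$, so it meets the bound. (c) For $n\ge 2$: the language $L_n$ has exactly $n$ quotients, all $2^n$ intersections of its uncomplemented or complemented quotients are non-empty (that is, are atoms), every atom of $L_n$ with $0$ or $n$ complemented quotients has quotient complexity exactly $2^n-1$, and, for $1\le r\le n-1$, every atom of $L_n$ with $r$ complemented quotients has quotient complexity exactly $f(n,r)$. -/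

import Mathlib

/-- The set of (left) quotients `w⁻¹L`, for `w` a word over `α`, of the language `L`. -/
def quotients {α : Type*} (L : Language α) : Set (Language α) :=
  Set.range L.leftQuotient

/-- The quotient complexity of `L`: the number of distinct quotients of `L`, as an element of
`ℕ∞` (so it equals `⊤` when there are infinitely many of them). -/
noncomputable def quotientComplexity {α : Type*} (L : Language α) : ℕ∞ :=
  (quotients L).encard

/-- The intersection of all the quotients of `L` in which exactly the quotients that belong to `C`
are complemented (with respect to the set of all words). -/
def atomicIntersection {α : Type*} (L : Language α) (C : Set (Language α)) : Language α :=
  (⨅ K ∈ quotients L \ C, K) ⊓ (⨅ K ∈ C, Kᶜ)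

/-- `A` is an atom of `L` with `r` complemented quotients: a non-empty intersection of all the
quotients of `L`, of which exactly `r` are complemented. -/
def IsAtomWith {α : Type*} (L : Language α) (r : ℕ) (A : Language α) : Prop :=
  ∃ C ⊆ quotients L, C.encard = r ∧ A = atomicIntersection L C ∧ ∃ w, w ∈ A

/-- The bound `f(n,r) = 1 + ∑_{k=1}^{r} ∑_{h=k+1}^{k+n-r} C(n,h) C(h,k)`, used for
`1 ≤ r ≤ n - 1`. -/
def atomBound (n r : ℕ) : ℕ :=
  1 + ∑ k ∈ Finset.Icc 1 r, ∑ h ∈ Finset.Icc (k + 1) (k + n - r), n.choose h * h.choose k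

/-- The alphabet `{a, b, c}` of the witness automata. -/
inductive WitnessLetter where
  | a
  | b
  | c

/-- The witness automaton with states `0, …, n-1`, initial state `0` and final state `n-1`: `a` is
the cycle `i ↦ i + 1 mod n`, `b` transposes `0` and `1`, and `c` maps `n-1` to `0` and fixes
every other state. -/
def witnessDFA (n : ℕ) (hn : 2 ≤ n) : DFA WitnessLetter (Fin n) where
  step i x := match x with
    | .a => ⟨(i.val + 1) % n, Nat.mod_lt _ (by omega)⟩
    | .b => if i.val = 0 then ⟨1, by omega⟩ else if i.val = 1 then ⟨0, by omega⟩ else i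
    | .c => if i.val = n - 1 then ⟨0, by omega⟩ else i
  start := ⟨0, by omega⟩
  accept := {⟨n - 1, by omega⟩}

/-- The language accepted by the witness automaton. -/
def witnessLanguage (n : ℕ) (hn : 2 ≤ n) : Language WitnessLetter :=
  (witnessDFA n hn).accepts

/-!
Let `Q` be the set of the `n` quotients of `L`. The atom in which the quotients in `C ⊆ Q` are
complemented is the intersection of the quotients in `Q \ C` with the complements of those in `C`.
Its quotient by a word `u` has the same shape: the two blocks `Q \ C` and `C` are replaced by their
images `X` and `Y` under `K ↦ u⁻¹K` (`leftQuotient_literalInter`). The images have at most `n - r`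
and `r` elements if `|C| = r`, are non-empty when the blocks are, and define the empty language
when they meet. So for `1 ≤ r ≤ n - 1` there are at most as many quotients as one plus the number
of pairs of disjoint non-empty subsets of these sizes; `one_add_card_disjointPairs` counts them by
`k = |Y|` and `h = |X ∪ Y|`. If one block is empty, the other one has one of the `2 ^ n - 1`
non-empty subsets of `Q` as its image.

The bounds are attained as soon as every self-map of `Q` is of the form `K ↦ u⁻¹K`
(`HasAllTransformations`) and `Q` has members with and without the empty word. Then the two blocks
can be mapped independently onto any non-empty sets of admissible sizes, and distinct disjoint
pairs define distinct non-empty languages, since any set of quotients is the set of those that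
contain some word. For the witness automaton, the cycle and the transposition generate the
symmetric group, and these together with a map that moves a single point generate all
transformations of the states.
-/

/-! ### Counting pairs of disjoint sets -/

theorem Finset.exists_image_eq_of_card_le {β : Type*} [DecidableEq β] {S X : Finset β}
    (hX : X.Nonempty) (h : X.card ≤ S.card) : ∃ f : β → β, S.image f = X := by
  obtain ⟨S', hS', hcard⟩ := Finset.exists_subset_card_eq h
  obtain ⟨x₀, hx₀⟩ := hX
  let e := Finset.equivOfCardEq hcard
  refine ⟨fun y => if hy : y ∈ S' then e ⟨y, hy⟩ else x₀, ?_⟩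
  ext x
  simp only [Finset.mem_image]
  constructor
  · rintro ⟨y, -, rfl⟩
    split_ifs
    · exact (e _).2
    · exact hx₀
  · intro hx
    refine ⟨e.symm ⟨x, hx⟩, hS' (e.symm ⟨x, hx⟩).2, ?_⟩
    simp

/-- The pairs `(X, Y)` of disjoint non-empty subsets of `Q` with `|X| ≤ s` and `|Y| ≤ r`. -/
def disjointPairs {β : Type*} [DecidableEq β] (Q : Finset β) (s r : ℕ) :
    Finset (Finset β × Finset β) :=
  (Q.powerset ×ˢ Q.powerset).filter fun p =>
    Disjoint p.1 p.2 ∧ p.1.Nonempty ∧ p.1.card ≤ s ∧ p.2.Nonempty ∧ p.2.card ≤ r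

theorem mem_disjointPairs {β : Type*} [DecidableEq β] {Q : Finset β} {s r : ℕ}
    {p : Finset β × Finset β} :
    p ∈ disjointPairs Q s r ↔ (p.1 ⊆ Q ∧ p.2 ⊆ Q) ∧
      Disjoint p.1 p.2 ∧ p.1.Nonempty ∧ p.1.card ≤ s ∧ p.2.Nonempty ∧ p.2.card ≤ r := by
  simp [disjointPairs]

/-- The bijection behind the count sends `(X, Y)` to `(|Y|, |X ∪ Y|, X ∪ Y, Y)`. -/
theorem one_add_card_disjointPairs {β : Type*} [DecidableEq β] (Q : Finset β) {r : ℕ}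
    (hr : r ≤ Q.card) : 1 + (disjointPairs Q (Q.card - r) r).card = atomBound Q.card r := by
  let T : Finset (Σ _ : ℕ, Σ _ : ℕ, Σ _ : Finset β, Finset β) :=
    (Finset.Icc 1 r).sigma fun k => (Finset.Icc (k + 1) (k + Q.card - r)).sigma fun h =>
      (Q.powersetCard h).sigma fun H => H.powersetCard k
  have hT : T.card = ∑ k ∈ Finset.Icc 1 r, ∑ h ∈ Finset.Icc (k + 1) (k + Q.card - r),
      Q.card.choose h * h.choose k := by
    simp only [T, Finset.card_sigma]
    refine Finset.sum_congr rfl fun k _ => Finset.sum_congr rfl fun h _ => ?_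
    rw [Finset.sum_congr rfl (g := fun _ => h.choose k), Finset.sum_const,
      Finset.card_powersetCard, smul_eq_mul]
    intro H hH
    rw [Finset.card_powersetCard, (Finset.mem_powersetCard.1 hH).2]
  rw [atomBound, ← hT]
  congr 1
  refine Finset.card_nbij' (fun p => ⟨p.2.card, (p.1 ∪ p.2).card, p.1 ∪ p.2, p.2⟩)
    (fun t => (t.2.2.1 \ t.2.2.2, t.2.2.2)) ?_ ?_ ?_ ?_
  · rintro ⟨X, Y⟩ h
    obtain ⟨⟨hX, hY⟩, hd, hXn, hXs, hYn, hYr⟩ := mem_disjointPairs.1 h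
    have := hXn.card_pos
    have := hYn.card_pos
    have hc := Finset.card_union_of_disjoint hd
    rw [Finset.mem_coe]
    simp only [T, Finset.mem_sigma, Finset.mem_Icc, Finset.mem_powersetCard]
    dsimp only at *
    exact ⟨by omega, by omega, ⟨Finset.union_subset hX hY, trivial⟩,
      Finset.subset_union_right, trivial⟩
  · rintro ⟨k, h, H, Y⟩ ht
    simp only [T, Finset.mem_coe, Finset.mem_sigma, Finset.mem_Icc,
      Finset.mem_powersetCard] at ht
    obtain ⟨hk, hh, ⟨hHQ, hHc⟩, hYH, hYc⟩ := ht
    have hc := Finset.card_sdiff_add_card_eq_card hYH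
    refine mem_disjointPairs.2 ⟨⟨Finset.sdiff_subset.trans hHQ, hYH.trans hHQ⟩,
      Finset.sdiff_disjoint, Finset.card_pos.1 ?_, ?_, Finset.card_pos.1 ?_, ?_⟩ <;>
    dsimp only <;> omega
  · rintro ⟨X, Y⟩ h
    have hd := (mem_disjointPairs.1 h).2.1
    simp [Finset.union_sdiff_cancel_right hd]
  · rintro ⟨k, h, H, Y⟩ ht
    simp only [T, Finset.mem_coe, Finset.mem_sigma, Finset.mem_Icc,
      Finset.mem_powersetCard] at ht
    obtain ⟨hk, hh, ⟨hHQ, rfl⟩, hYH, rfl⟩ := ht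
    simp [Finset.sdiff_union_of_subset hYH]

/-! ### Quotients of intersections of literals -/

/-- The words that lie in every language of `X` and in no language of `Y`. -/
def literalInter {α : Type*} (X Y : Finset (Language α)) : Language α :=
  {w | (∀ K ∈ X, w ∈ K) ∧ ∀ K ∈ Y, w ∉ K}

theorem mem_literalInter {α : Type*} {X Y : Finset (Language α)} {w : List α} :
    w ∈ literalInter X Y ↔ (∀ K ∈ X, w ∈ K) ∧ ∀ K ∈ Y, w ∉ K := Iff.rfl

open Classical in
theorem leftQuotient_literalInter {α : Type*} (X Y : Finset (Language α)) (u : List α) :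
    (literalInter X Y).leftQuotient u =
      literalInter (X.image fun K => K.leftQuotient u) (Y.image fun K => K.leftQuotient u) := by
  ext w
  simp [Language.mem_leftQuotient, mem_literalInter]

theorem literalInter_eq_bot {α : Type*} {X Y : Finset (Language α)} (h : ¬ Disjoint X Y) :
    literalInter X Y = ⊥ := by
  obtain ⟨K, hX, hY⟩ := Finset.not_disjoint_iff.1 h
  exact eq_bot_iff.2 fun w hw => hw.2 K hY (hw.1 K hX)

theorem mem_atomicIntersection {α : Type*} {L : Language α} {C : Set (Language α)} {w : List α} :
    w ∈ atomicIntersection L C ↔ (∀ K ∈ quotients L \ C, w ∈ K) ∧ ∀ K ∈ C, w ∉ K := by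
  have h₁ : ∀ S : Set (Language α), w ∈ (⨅ K ∈ S, K) ↔ ∀ K ∈ S, w ∈ K := fun S => by
    change w ∈ (⨅ K ∈ S, (K : Set (List α))) ↔ _
    exact Set.mem_iInter₂
  have h₂ : w ∈ (⨅ K ∈ C, Kᶜ) ↔ ∀ K ∈ C, w ∉ K := by
    change w ∈ (⨅ K ∈ C, (K : Set (List α))ᶜ) ↔ _
    exact Set.mem_iInter₂
  exact and_congr (h₁ _) h₂

open Classical in
theorem atomicIntersection_eq_literalInter {α : Type*} {L : Language α} {Q C : Finset (Language α)}
    (hQ : (Q : Set (Language α)) = quotients L) :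
    atomicIntersection L C = literalInter (Q \ C) C := by
  ext w
  rw [mem_atomicIntersection, mem_literalInter, ← hQ]
  simp

theorem leftQuotient_mem_quotients {α : Type*} {L K : Language α} (hK : K ∈ quotients L)
    (u : List α) : K.leftQuotient u ∈ quotients L := by
  obtain ⟨v, rfl⟩ := hK
  exact ⟨v ++ u, L.leftQuotient_append v u⟩

theorem exists_finset_eq_quotients {α : Type*} {L : Language α} {n : ℕ}
    (h : quotientComplexity L = n) :
    ∃ Q : Finset (Language α), (Q : Set (Language α)) = quotients L ∧ Q.card = n := by
  have hfin : (quotients L).Finite := Set.finite_of_encard_eq_coe h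
  refine ⟨hfin.toFinset, hfin.coe_toFinset, ?_⟩
  have := hfin.encard_eq_coe_toFinset_card
  rw [quotientComplexity, this] at h
  exact_mod_cast h

open Classical in
theorem IsAtomWith.exists_eq_literalInter {α : Type*} {L A : Language α} {r : ℕ}
    {Q : Finset (Language α)} (hQ : (Q : Set (Language α)) = quotients L)
    (h : IsAtomWith L r A) :
    ∃ C ⊆ Q, C.card = r ∧ A = literalInter (Q \ C) C := by
  obtain ⟨C, hC, hr, hA, -⟩ := h
  have hfin : C.Finite := (hQ ▸ Q.finite_toSet).subset hC
  lift C to Finset (Language α) using hfin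
  refine ⟨C, by exact_mod_cast hQ ▸ hC, by simpa using hr, ?_⟩
  rw [hA, atomicIntersection_eq_literalInter hQ]

/-! ### Upper bounds -/

section UpperBounds

variable {α : Type*} {L : Language α} {Q : Finset (Language α)}

open Classical in
theorem image_leftQuotient_subset (hQ : (Q : Set (Language α)) = quotients L)
    {S : Finset (Language α)} (hS : S ⊆ Q) (u : List α) :
    S.image (fun K => K.leftQuotient u) ⊆ Q := by
  intro K hK
  obtain ⟨K', hK', rfl⟩ := Finset.mem_image.1 hK
  have : K' ∈ quotients L := hQ ▸ Finset.mem_coe.2 (hS hK')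
  have := leftQuotient_mem_quotients this u
  rwa [← hQ] at this

open Classical in
theorem quotients_literalInter_empty_right_subset (hQ : (Q : Set (Language α)) = quotients L)
    (hne : Q.Nonempty) :
    quotients (literalInter Q ∅) ⊆
      (fun X => literalInter X ∅) ''
        ((Q.powerset.erase ∅ : Finset (Finset (Language α))) : Set (Finset (Language α))) := by
  rintro _ ⟨u, rfl⟩
  refine ⟨_, ?_, (leftQuotient_literalInter Q ∅ u).symm⟩
  rw [Finset.mem_coe, Finset.mem_erase, Finset.mem_powerset]
  exact ⟨(hne.image _).ne_empty, image_leftQuotient_subset hQ subset_rfl u⟩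

open Classical in
theorem quotients_literalInter_empty_left_subset (hQ : (Q : Set (Language α)) = quotients L)
    (hne : Q.Nonempty) :
    quotients (literalInter ∅ Q) ⊆
      (fun Y => literalInter ∅ Y) ''
        ((Q.powerset.erase ∅ : Finset (Finset (Language α))) : Set (Finset (Language α))) := by
  rintro _ ⟨u, rfl⟩
  refine ⟨_, ?_, (leftQuotient_literalInter ∅ Q u).symm⟩
  rw [Finset.mem_coe, Finset.mem_erase, Finset.mem_powerset]
  exact ⟨(hne.image _).ne_empty, image_leftQuotient_subset hQ subset_rfl u⟩

open Classical in
theorem quotients_literalInter_subset (hQ : (Q : Set (Language α)) = quotients L)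
    {C : Finset (Language α)} (hC : C ⊆ Q) (hpos : 1 ≤ C.card) (hlt : C.card < Q.card) :
    quotients (literalInter (Q \ C) C) ⊆
      insert ⊥ ((fun p : Finset (Language α) × Finset (Language α) => literalInter p.1 p.2) ''
        (disjointPairs Q (Q.card - C.card) C.card :
          Set (Finset (Language α) × Finset (Language α)))) := by
  rintro _ ⟨u, rfl⟩
  rw [leftQuotient_literalInter]
  by_cases hd : Disjoint ((Q \ C).image fun K => K.leftQuotient u)
    (C.image fun K => K.leftQuotient u)
  · refine Or.inr ⟨(_, _), mem_disjointPairs.2 ⟨⟨image_leftQuotient_subset hQ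
      Finset.sdiff_subset u, image_leftQuotient_subset hQ hC u⟩, hd, ?_, ?_, ?_,
      Finset.card_image_le⟩, rfl⟩
    · refine Finset.Nonempty.image (Finset.card_pos.1 ?_) _
      rw [Finset.card_sdiff_of_subset hC]
      omega
    · exact Finset.card_image_le.trans (Finset.card_sdiff_of_subset hC).le
    · exact (Finset.card_pos.1 hpos).image _
  · exact Or.inl (literalInter_eq_bot hd)

theorem card_powerset_erase_empty {β : Type*} [DecidableEq β] (Q : Finset β) :
    (Q.powerset.erase ∅).card = 2 ^ Q.card - 1 := by
  rw [Finset.card_erase_of_mem (Finset.empty_mem_powerset Q), Finset.card_powerset]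

theorem nonempty_of_coe_eq_quotients (hQ : (Q : Set (Language α)) = quotients L) :
    Q.Nonempty := by
  rw [← Finset.coe_nonempty, hQ]
  exact Set.range_nonempty _

theorem eq_literalInter_of_isAtomWith_zero_or_card {A : Language α}
    (hQ : (Q : Set (Language α)) = quotients L)
    (hA : IsAtomWith L 0 A ∨ IsAtomWith L Q.card A) :
    A = literalInter Q ∅ ∨ A = literalInter ∅ Q := by
  classical
  rcases hA with hA | hA
  · obtain ⟨C, -, hC, rfl⟩ := hA.exists_eq_literalInter hQ
    obtain rfl := Finset.card_eq_zero.1 hC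
    simp
  · obtain ⟨C, hCQ, hC, rfl⟩ := hA.exists_eq_literalInter hQ
    obtain rfl := Finset.eq_of_subset_of_card_le hCQ hC.ge
    simp

theorem quotientComplexity_le_of_isAtomWith_zero_or_card {A : Language α}
    (hQ : (Q : Set (Language α)) = quotients L)
    (hA : IsAtomWith L 0 A ∨ IsAtomWith L Q.card A) :
    quotientComplexity A ≤ ((2 ^ Q.card - 1 : ℕ) : ℕ∞) := by
  classical
  have hne := nonempty_of_coe_eq_quotients hQ
  rw [← card_powerset_erase_empty, ← Set.encard_coe_eq_coe_finsetCard]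
  rcases eq_literalInter_of_isAtomWith_zero_or_card hQ hA with rfl | rfl
  · exact (Set.encard_le_encard (quotients_literalInter_empty_right_subset hQ hne)).trans
      (Set.encard_image_le _ _)
  · exact (Set.encard_le_encard (quotients_literalInter_empty_left_subset hQ hne)).trans
      (Set.encard_image_le _ _)

theorem quotientComplexity_le_of_isAtomWith {A : Language α} {r : ℕ}
    (hQ : (Q : Set (Language α)) = quotients L) (hr₁ : 1 ≤ r) (hr₂ : r < Q.card)
    (hA : IsAtomWith L r A) : quotientComplexity A ≤ (atomBound Q.card r : ℕ∞) := by
  classical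
  obtain ⟨C, hC, rfl, rfl⟩ := hA.exists_eq_literalInter hQ
  refine (Set.encard_le_encard (quotients_literalInter_subset hQ hC hr₁ hr₂)).trans ?_
  refine (Set.encard_insert_le _ _).trans ?_
  rw [← one_add_card_disjointPairs Q hr₂.le, add_comm, Nat.cast_add,
    ← Set.encard_coe_eq_coe_finsetCard]
  exact add_le_add le_rfl (Set.encard_image_le _ _)

end UpperBounds

/-! ### Languages whose quotients admit every transformation -/

/-- Every self-map of the set of quotients of `L` is `K ↦ u⁻¹K` for some word `u`; in terms of
the minimal automaton of `L`, its transition monoid is the full transformation monoid. -/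
def HasAllTransformations {α : Type*} (L : Language α) : Prop :=
  ∀ f : Language α → Language α, Set.MapsTo f (quotients L) (quotients L) →
    ∃ u, ∀ K ∈ quotients L, K.leftQuotient u = f K

section AllTransformations

variable {α : Type*} {L : Language α} {Q : Finset (Language α)} {K₀ K₁ : Language α}

/-- A word acting as the map with value `K₁ ∋ ε` on `S` and `K₀ ∌ ε` off `S` lies in exactly the
quotients that belong to `S`. -/
theorem HasAllTransformations.exists_mem_iff (hL : HasAllTransformations L)
    (h₀ : K₀ ∈ quotients L) (h₁ : K₁ ∈ quotients L) (hn₀ : [] ∉ K₀) (hn₁ : [] ∈ K₁)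
    (S : Set (Language α)) : ∃ w, ∀ K ∈ quotients L, (w ∈ K ↔ K ∈ S) := by
  classical
  obtain ⟨w, hw⟩ := hL (fun K => if K ∈ S then K₁ else K₀) fun K _ => by
    dsimp only; split_ifs <;> assumption
  refine ⟨w, fun K hK => ?_⟩
  have : w ∈ K ↔ [] ∈ K.leftQuotient w := by simp [Language.mem_leftQuotient]
  rw [this, hw K hK]
  split_ifs <;> simp [*]

theorem HasAllTransformations.exists_mem_atomicIntersection (hL : HasAllTransformations L)
    (h₀ : K₀ ∈ quotients L) (h₁ : K₁ ∈ quotients L) (hn₀ : [] ∉ K₀) (hn₁ : [] ∈ K₁)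
    {C : Set (Language α)} (hC : C ⊆ quotients L) : ∃ w, w ∈ atomicIntersection L C := by
  obtain ⟨w, hw⟩ := hL.exists_mem_iff h₀ h₁ hn₀ hn₁ Cᶜ
  exact ⟨w, mem_atomicIntersection.2 ⟨fun K hK => (hw K hK.1).2 hK.2,
    fun K hK hwK => (hw K (hC hK)).1 hwK hK⟩⟩

/-- Distinct pairs of disjoint sets of quotients define distinct intersections: a word that lies
in exactly the quotients in `X` shows that the first component of the other pair is contained in
`X`, and a word that lies in exactly the quotients outside `Y` does the same for the second. -/
theorem HasAllTransformations.literalInter_subset (hL : HasAllTransformations L)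
    (hQ : (Q : Set (Language α)) = quotients L)
    (h₀ : K₀ ∈ quotients L) (h₁ : K₁ ∈ quotients L) (hn₀ : [] ∉ K₀) (hn₁ : [] ∈ K₁)
    {X Y X' Y' : Finset (Language α)} (hX : X ⊆ Q) (hY : Y ⊆ Q) (hX' : X' ⊆ Q) (hY' : Y' ⊆ Q)
    (hd : Disjoint X Y) (h : literalInter X Y = literalInter X' Y') : X' ⊆ X ∧ Y' ⊆ Y := by
  have hmem : ∀ {S : Finset (Language α)}, S ⊆ Q → ∀ {K}, K ∈ S → K ∈ quotients L :=
    fun hS K hK => hQ ▸ Finset.mem_coe.2 (hS hK)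
  constructor
  · obtain ⟨w, hw⟩ := hL.exists_mem_iff h₀ h₁ hn₀ hn₁ (X : Set (Language α))
    have : w ∈ literalInter X Y := ⟨fun K hK => (hw K (hmem hX hK)).2 hK,
      fun K hK hwK => Finset.disjoint_left.1 hd ((hw K (hmem hY hK)).1 hwK) hK⟩
    rw [h] at this
    exact fun K hK => (hw K (hmem hX' hK)).1 (this.1 K hK)
  · obtain ⟨w, hw⟩ := hL.exists_mem_iff h₀ h₁ hn₀ hn₁ ((Y : Set (Language α))ᶜ)
    have : w ∈ literalInter X Y := ⟨fun K hK => (hw K (hmem hX hK)).2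
      fun hKY => Finset.disjoint_left.1 hd hK hKY,
      fun K hK hwK => (hw K (hmem hY hK)).1 hwK hK⟩
    rw [h] at this
    intro K hK
    by_contra hKY
    exact this.2 K hK ((hw K (hmem hY' hK)).2 hKY)

theorem HasAllTransformations.literalInter_inj (hL : HasAllTransformations L)
    (hQ : (Q : Set (Language α)) = quotients L)
    (h₀ : K₀ ∈ quotients L) (h₁ : K₁ ∈ quotients L) (hn₀ : [] ∉ K₀) (hn₁ : [] ∈ K₁)
    {X Y X' Y' : Finset (Language α)} (hX : X ⊆ Q) (hY : Y ⊆ Q) (hX' : X' ⊆ Q) (hY' : Y' ⊆ Q)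
    (hd : Disjoint X Y) (hd' : Disjoint X' Y') (h : literalInter X Y = literalInter X' Y') :
    X = X' ∧ Y = Y' := by
  have h₂ := hL.literalInter_subset hQ h₀ h₁ hn₀ hn₁ hX hY hX' hY' hd h
  have h₃ := hL.literalInter_subset hQ h₀ h₁ hn₀ hn₁ hX' hY' hX hY hd' h.symm
  exact ⟨h₃.1.antisymm h₂.1, h₃.2.antisymm h₂.2⟩

theorem HasAllTransformations.literalInter_ne_bot (hL : HasAllTransformations L)
    (hQ : (Q : Set (Language α)) = quotients L)
    (h₀ : K₀ ∈ quotients L) (h₁ : K₁ ∈ quotients L) (hn₀ : [] ∉ K₀) (hn₁ : [] ∈ K₁)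
    {X Y : Finset (Language α)} (hX : X ⊆ Q) (hY : Y ⊆ Q) (hd : Disjoint X Y) :
    literalInter X Y ≠ ⊥ := by
  obtain ⟨w, hw⟩ := hL.exists_mem_iff h₀ h₁ hn₀ hn₁ (X : Set (Language α))
  intro h
  have : w ∈ literalInter X Y :=
    ⟨fun K hK => (hw K (hQ ▸ Finset.mem_coe.2 (hX hK))).2 hK,
      fun K hK hwK => Finset.disjoint_left.1 hd
        ((hw K (hQ ▸ Finset.mem_coe.2 (hY hK))).1 hwK) hK⟩
  rw [h] at this
  exact this

/-- Any two subsets of the quotients that are non-empty and no larger than the two blocks `Q \ C`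
and `C` are the images of these blocks under one word. -/
theorem HasAllTransformations.literalInter_mem_quotients [DecidableEq (Language α)]
    (hL : HasAllTransformations L)
    (hQ : (Q : Set (Language α)) = quotients L) {C X Y : Finset (Language α)} (hC : C ⊆ Q)
    (hX : X ⊆ Q) (hY : Y ⊆ Q) (hXC : ∃ f : Language α → Language α, (Q \ C).image f = X)
    (hYC : ∃ f : Language α → Language α, C.image f = Y) :
    literalInter X Y ∈ quotients (literalInter (Q \ C) C) := by
  obtain ⟨f, rfl⟩ := hXC
  obtain ⟨g, rfl⟩ := hYC
  obtain ⟨u, hu⟩ := hL (fun K => if K ∈ C then g K else f K) fun K hK => by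
    rw [← hQ] at hK ⊢
    dsimp only
    split_ifs with h
    · exact hY (Finset.mem_image_of_mem _ h)
    · exact hX (Finset.mem_image_of_mem _ (Finset.mem_sdiff.2 ⟨hK, h⟩))
  refine ⟨u, ?_⟩
  have h₁ : (Q \ C).image (fun K => K.leftQuotient u) = (Q \ C).image f := by
    refine Finset.image_congr fun K hK => ?_
    obtain ⟨hK, hKC⟩ := Finset.mem_sdiff.1 (Finset.mem_coe.1 hK)
    rw [hu K (hQ ▸ Finset.mem_coe.2 hK), if_neg hKC]
  have h₂ : C.image (fun K => K.leftQuotient u) = C.image g := by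
    refine Finset.image_congr fun K hK => ?_
    rw [hu K (hQ ▸ Finset.mem_coe.2 (hC hK)), if_pos (Finset.mem_coe.1 hK)]
  rw [← h₁, ← h₂]
  convert leftQuotient_literalInter (Q \ C) C u

theorem HasAllTransformations.quotientComplexity_eq_of_isAtomWith_zero_or_card
    (hL : HasAllTransformations L) (hQ : (Q : Set (Language α)) = quotients L)
    (h₀ : K₀ ∈ quotients L) (h₁ : K₁ ∈ quotients L) (hn₀ : [] ∉ K₀) (hn₁ : [] ∈ K₁)
    {A : Language α} (hA : IsAtomWith L 0 A ∨ IsAtomWith L Q.card A) :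
    quotientComplexity A = ((2 ^ Q.card - 1 : ℕ) : ℕ∞) := by
  classical
  refine (quotientComplexity_le_of_isAtomWith_zero_or_card hQ hA).antisymm ?_
  rw [← card_powerset_erase_empty, ← Set.encard_coe_eq_coe_finsetCard]
  have hmem : ∀ {X}, X ∈ Q.powerset.erase ∅ → X.Nonempty ∧ X ⊆ Q := by
    simp +contextual [Finset.nonempty_iff_ne_empty]
  have e : ∅ ⊆ Q := Finset.empty_subset Q
  rcases eq_literalInter_of_isAtomWith_zero_or_card hQ hA with rfl | rfl
  · have hinj : Set.InjOn (fun X => literalInter X ∅) (Q.powerset.erase ∅ : Finset _) :=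
      fun X hX X' hX' h => (hL.literalInter_inj hQ h₀ h₁ hn₀ hn₁ (hmem hX).2 e (hmem hX').2 e
        (Finset.disjoint_empty_right _) (Finset.disjoint_empty_right _) h).1
    rw [← hinj.encard_image]
    refine Set.encard_le_encard ?_
    rintro _ ⟨X, hX, rfl⟩
    obtain ⟨hXn, hXQ⟩ := hmem hX
    simpa using hL.literalInter_mem_quotients hQ (C := ∅) e hXQ e
      (Finset.exists_image_eq_of_card_le hXn (by simpa using Finset.card_le_card hXQ))
      ⟨id, by simp⟩
  · have hinj : Set.InjOn (fun Y => literalInter ∅ Y) (Q.powerset.erase ∅ : Finset _) :=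
      fun X hX X' hX' h => (hL.literalInter_inj hQ h₀ h₁ hn₀ hn₁ e (hmem hX).2 e (hmem hX').2
        (Finset.disjoint_empty_left _) (Finset.disjoint_empty_left _) h).2
    rw [← hinj.encard_image]
    refine Set.encard_le_encard ?_
    rintro _ ⟨Y, hY, rfl⟩
    obtain ⟨hYn, hYQ⟩ := hmem hY
    simpa using hL.literalInter_mem_quotients hQ (C := Q) subset_rfl e hYQ
      ⟨id, by simp⟩ (Finset.exists_image_eq_of_card_le hYn (Finset.card_le_card hYQ))

theorem HasAllTransformations.quotientComplexity_eq_of_isAtomWith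
    (hL : HasAllTransformations L) (hQ : (Q : Set (Language α)) = quotients L)
    (h₀ : K₀ ∈ quotients L) (h₁ : K₁ ∈ quotients L) (hn₀ : [] ∉ K₀) (hn₁ : [] ∈ K₁)
    {A : Language α} {r : ℕ} (hr₁ : 1 ≤ r) (hr₂ : r < Q.card) (hA : IsAtomWith L r A) :
    quotientComplexity A = (atomBound Q.card r : ℕ∞) := by
  classical
  refine (quotientComplexity_le_of_isAtomWith hQ hr₁ hr₂ hA).antisymm ?_
  obtain ⟨C, hC, rfl, rfl⟩ := hA.exists_eq_literalInter hQ
  have hcard := Finset.card_sdiff_of_subset hC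
  set P := disjointPairs Q (Q.card - C.card) C.card with hP
  have hinj : Set.InjOn
      (fun p : Finset (Language α) × Finset (Language α) => literalInter p.1 p.2)
      (P : Set (Finset (Language α) × Finset (Language α))) := by
    intro p hp p' hp' h
    obtain ⟨⟨hX, hY⟩, hd, -⟩ := mem_disjointPairs.1 hp
    obtain ⟨⟨hX', hY'⟩, hd', -⟩ := mem_disjointPairs.1 hp'
    exact Prod.ext_iff.2 (hL.literalInter_inj hQ h₀ h₁ hn₀ hn₁ hX hY hX' hY' hd hd' h)
  have hbot : ⊥ ∉
      (fun p : Finset (Language α) × Finset (Language α) => literalInter p.1 p.2) ''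
      (P : Set (Finset (Language α) × Finset (Language α))) := by
    rintro ⟨p, hp, h⟩
    obtain ⟨⟨hX, hY⟩, hd, -⟩ := mem_disjointPairs.1 hp
    exact hL.literalInter_ne_bot hQ h₀ h₁ hn₀ hn₁ hX hY hd h
  rw [← one_add_card_disjointPairs Q hr₂.le, ← hP, add_comm, Nat.cast_add, Nat.cast_one,
    ← Set.encard_coe_eq_coe_finsetCard, ← hinj.encard_image,
    ← Set.encard_insert_of_notMem hbot]
  refine Set.encard_le_encard (Set.insert_subset ?_ ?_)
  · -- The constant map with value `K₀` sends both blocks to `{K₀}`.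
    have hK₀ : {K₀} ⊆ Q := by
      rw [Finset.singleton_subset_iff, ← Finset.mem_coe, hQ]
      exact h₀
    rw [← literalInter_eq_bot (X := {K₀}) (Y := {K₀}) (by simp)]
    exact hL.literalInter_mem_quotients hQ hC hK₀ hK₀
      (Finset.exists_image_eq_of_card_le (by simp) (by rw [Finset.card_singleton]; omega))
      (Finset.exists_image_eq_of_card_le (by simp) (by rw [Finset.card_singleton]; omega))
  · rintro _ ⟨p, hp, rfl⟩
    obtain ⟨⟨hX, hY⟩, -, hXn, hXc, hYn, hYc⟩ := mem_disjointPairs.1 hp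
    exact hL.literalInter_mem_quotients hQ hC hX hY
      (Finset.exists_image_eq_of_card_le hXn (hXc.trans hcard.ge))
      (Finset.exists_image_eq_of_card_le hYn hYc)

end AllTransformations

/-! ### The transformations of the witness automaton -/

/-- The transformation `f` of the states of `M` is the action of some word. -/
def DFA.Induces {α σ : Type*} (M : DFA α σ) (f : σ → σ) : Prop :=
  ∃ u, ∀ q, M.evalFrom q u = f q

theorem DFA.Induces.comp {α σ : Type*} {M : DFA α σ} {f g : σ → σ} (hf : M.Induces f)
    (hg : M.Induces g) : M.Induces (f ∘ g) := by
  obtain ⟨u, hu⟩ := hf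
  obtain ⟨v, hv⟩ := hg
  exact ⟨v ++ u, fun q => by rw [M.evalFrom_of_append, hv, hu, Function.comp_apply]⟩

section Generation

variable {α σ : Type*} {M : DFA α σ} [DecidableEq σ]

/-- The maps that move a single point are conjugate to each other under permutations. -/
theorem DFA.Induces.update_of_perm (hperm : ∀ π : Equiv.Perm σ, M.Induces π) {x y : σ}
    (hxy : x ≠ y) (hc : M.Induces (Function.update id x y)) {i j : σ} (hij : i ≠ j) :
    M.Induces (Function.update id i j) := by
  obtain ⟨π, hx, hy⟩ : ∃ π : Equiv.Perm σ, π x = i ∧ π y = j := by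
    have hi : i ≠ Equiv.swap x i y := fun h => hxy <| (Equiv.swap x i).injective <| by
      rw [Equiv.swap_apply_left]; exact h
    refine ⟨Equiv.swap (Equiv.swap x i y) j * Equiv.swap x i, ?_, ?_⟩
    · rw [Equiv.Perm.mul_apply, Equiv.swap_apply_left, Equiv.swap_apply_of_ne_of_ne hi hij]
    · rw [Equiv.Perm.mul_apply, Equiv.swap_apply_left]
  have h := (hperm π).comp (hc.comp (hperm π.symm))
  convert h using 1
  funext q
  by_cases hq : q = i
  · subst hq
    simp [← hx, hy]
  · have : π.symm q ≠ x := fun h => hq <| by rw [← hx, ← h, Equiv.apply_symm_apply]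
    simp [hq, Function.update_of_ne this]

/-- The permutations and one map that moves a single point generate all transformations: if
`f i = f j` with `i ≠ j` and `p` is not a value of `f`, then `f` is the map with image larger by
one that agrees with `f` except for `i ↦ p`, followed by the map that moves only `p`, to `f j`. -/
theorem DFA.Induces.of_perm_of_update [Fintype σ] (hperm : ∀ π : Equiv.Perm σ, M.Induces π)
    {x y : σ} (hxy : x ≠ y) (hc : M.Induces (Function.update id x y)) (f : σ → σ) :
    M.Induces f := by
  induction hm : Fintype.card σ - (Finset.univ.image f).card using Nat.strong_induction_on
    generalizing f with
  | _ m ih =>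
  subst hm
  by_cases hf : Function.Injective f
  · exact hperm (Equiv.ofBijective f (Finite.injective_iff_bijective.1 hf))
  obtain ⟨p, hp⟩ : ∃ p, ∀ q, f q ≠ p := by
    simpa [Function.Surjective] using mt Finite.injective_iff_surjective.2 hf
  obtain ⟨i, j, hfij, hij⟩ := Function.not_injective_iff.1 hf
  have himg : Finset.univ.image (Function.update f i p) = insert p (Finset.univ.image f) := by
    ext z
    simp only [Finset.mem_image, Finset.mem_univ, true_and, Finset.mem_insert]
    constructor
    · rintro ⟨q, rfl⟩
      by_cases hq : q = i
      · left; simp [hq]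
      · right; exact ⟨q, by simp [hq]⟩
    · rintro (rfl | ⟨q, rfl⟩)
      · exact ⟨i, by simp⟩
      · by_cases hq : q = i
        · exact ⟨j, by rw [Function.update_of_ne hij.symm, hq, hfij]⟩
        · exact ⟨q, by simp [hq]⟩
  have hcard : (Finset.univ.image (Function.update f i p)).card
      = (Finset.univ.image f).card + 1 := by
    rw [himg, Finset.card_insert_of_notMem]
    simpa using hp
  have hle := Finset.card_le_univ (Finset.univ.image (Function.update f i p))
  have h := (update_of_perm hperm hxy hc (hp j).symm).comp
    (ih _ (by omega) (Function.update f i p) rfl)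
  convert h using 1
  funext q
  by_cases hq : q = i
  · simp [hq, hfij]
  · simp [hq, Function.update_of_ne (hp q)]

end Generation

theorem witnessDFA_induces_perm {n : ℕ} (hn : 2 ≤ n) (π : Equiv.Perm (Fin n)) :
    (witnessDFA n hn).Induces π := by
  obtain ⟨m, rfl⟩ := Nat.exists_eq_add_of_le' hn
  let N : Submonoid (Equiv.Perm (Fin (m + 2))) :=
    { carrier := {π | (witnessDFA (m + 2) hn).Induces π}
      mul_mem' := fun hf hg => hf.comp hg
      one_mem' := ⟨[], fun _ => rfl⟩ }
  have ha : finRotate (m + 2) ∈ N := by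
    refine ⟨[.a], fun q => Fin.ext ?_⟩
    rw [DFA.evalFrom_singleton, coe_finRotate]
    change (q.val + 1) % (m + 2) = _
    split_ifs with h
    · simp [h]
    · have : q.val ≠ m + 1 := fun h' => h (Fin.ext h')
      exact Nat.mod_eq_of_lt (by omega)
  have hb : Equiv.swap 0 (finRotate (m + 2) 0) ∈ N := by
    refine ⟨[.b], fun q => Fin.ext ?_⟩
    rw [DFA.evalFrom_singleton, finRotate_apply_zero, Equiv.swap_apply_def]
    simp only [witnessDFA, Fin.ext_iff, Fin.val_zero, Fin.val_one]
    split_ifs <;> rfl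
  have hle : Submonoid.closure {finRotate (m + 2), Equiv.swap 0 (finRotate (m + 2) 0)} ≤ N :=
    Submonoid.closure_le.2 (Set.insert_subset ha (Set.singleton_subset_iff.2 hb))
  rw [← Subgroup.closure_toSubmonoid_of_finite,
    Equiv.Perm.closure_cycle_adjacent_swap isCycle_finRotate support_finRotate] at hle
  exact hle (Subgroup.mem_top π)

theorem witnessDFA_induces {n : ℕ} (hn : 2 ≤ n) (f : Fin n → Fin n) :
    (witnessDFA n hn).Induces f := by
  refine DFA.Induces.of_perm_of_update (witnessDFA_induces_perm hn)
    (x := ⟨n - 1, by omega⟩) (y := ⟨0, by omega⟩) (by simp [Fin.ext_iff]; omega)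
    ⟨[.c], fun q => ?_⟩ f
  rw [DFA.evalFrom_singleton]
  simp only [witnessDFA, Function.update_apply, Fin.ext_iff, id]

/-! ### The quotients of the witness language -/

section Witness

variable {n : ℕ} (hn : 2 ≤ n)

theorem leftQuotient_acceptsFrom {α σ : Type*} (M : DFA α σ) (q : σ) (u : List α) :
    (M.acceptsFrom q).leftQuotient u = M.acceptsFrom (M.evalFrom q u) := by
  ext w
  rw [Language.mem_leftQuotient, DFA.mem_acceptsFrom, DFA.mem_acceptsFrom,
    DFA.evalFrom_of_append]

theorem quotients_witnessLanguage :
    quotients (witnessLanguage n hn) = Set.range (witnessDFA n hn).acceptsFrom := by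
  ext K
  constructor
  · rintro ⟨u, rfl⟩
    exact ⟨_, (leftQuotient_acceptsFrom _ _ u).symm⟩
  · rintro ⟨q, rfl⟩
    obtain ⟨u, hu⟩ := witnessDFA_induces hn fun _ => q
    exact ⟨u, by rw [witnessLanguage, DFA.accepts, leftQuotient_acceptsFrom, hu]⟩

theorem nil_mem_acceptsFrom_witnessDFA (q : Fin n) :
    [] ∈ (witnessDFA n hn).acceptsFrom q ↔ q.val = n - 1 := by
  rw [DFA.mem_acceptsFrom, DFA.evalFrom_nil]
  exact Set.mem_singleton_iff.trans Fin.ext_iff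

theorem injective_acceptsFrom_witnessDFA :
    Function.Injective (witnessDFA n hn).acceptsFrom := by
  intro p q h
  by_contra hpq
  obtain ⟨u, hu⟩ := witnessDFA_induces hn
    fun i => if i = p then ⟨n - 1, by omega⟩ else ⟨0, by omega⟩
  have h' := congrArg (fun K : Language _ => [] ∈ K.leftQuotient u) h
  simp only [leftQuotient_acceptsFrom, hu, nil_mem_acceptsFrom_witnessDFA, if_true,
    if_neg (Ne.symm hpq), eq_iff_iff, true_iff] at h'
  omega

theorem quotientComplexity_witnessLanguage : quotientComplexity (witnessLanguage n hn) = n := by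
  rw [quotientComplexity, quotients_witnessLanguage, ← Set.image_univ,
    (injective_acceptsFrom_witnessDFA hn).encard_image, Set.encard_univ]
  simp

theorem hasAllTransformations_witnessLanguage :
    HasAllTransformations (witnessLanguage n hn) := by
  intro f hf
  rw [quotients_witnessLanguage] at hf ⊢
  choose g hg using fun q => hf (Set.mem_range_self q)
  obtain ⟨u, hu⟩ := witnessDFA_induces hn g
  refine ⟨u, ?_⟩
  rintro _ ⟨q, rfl⟩
  rw [leftQuotient_acceptsFrom, hu, hg]

theorem exists_quotients_witnessLanguage :
    ∃ K₀ ∈ quotients (witnessLanguage n hn), ∃ K₁ ∈ quotients (witnessLanguage n hn),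
      [] ∉ K₀ ∧ [] ∈ K₁ := by
  rw [quotients_witnessLanguage]
  refine ⟨_, ⟨⟨0, by omega⟩, rfl⟩, _, ⟨⟨n - 1, by omega⟩, rfl⟩, ?_, ?_⟩ <;>
  rw [nil_mem_acceptsFrom_witnessDFA]
  change 0 ≠ n - 1
  omega

end Witness

/-! ### The languages with one quotient -/

theorem quotients_top {α : Type*} : quotients (⊤ : Language α) = {⊤} := by
  ext K
  exact ⟨fun ⟨_, hu⟩ => hu.symm, fun hK => ⟨[], hK.symm⟩⟩

theorem quotients_bot {α : Type*} : quotients (⊥ : Language α) = {⊥} := by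
  ext K
  exact ⟨fun ⟨_, hu⟩ => hu.symm, fun hK => ⟨[], hK.symm⟩⟩

theorem isAtomWith_top {α : Type*} {r : ℕ} {A : Language α} :
    IsAtomWith (⊤ : Language α) r A ↔ r = 0 ∧ A = ⊤ := by
  have h₀ : atomicIntersection (⊤ : Language α) ∅ = ⊤ := by
    simp [atomicIntersection, quotients_top]
  constructor
  · rintro ⟨C, hC, hr, rfl, w, hw⟩
    rw [quotients_top] at hC
    rcases Set.subset_singleton_iff_eq.1 hC with rfl | rfl
    · exact ⟨by simpa using hr.symm, h₀⟩
    · exact ((mem_atomicIntersection.1 hw).2 ⊤ rfl trivial).elim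
  · rintro ⟨rfl, rfl⟩
    exact ⟨∅, Set.empty_subset _, by simp, h₀.symm, [], trivial⟩

theorem isAtomWith_bot {α : Type*} {r : ℕ} {A : Language α} :
    IsAtomWith (⊥ : Language α) r A ↔ r = 1 ∧ A = ⊤ := by
  have h₁ : atomicIntersection (⊥ : Language α) {⊥} = ⊤ := by
    simp [atomicIntersection, quotients_bot]
  constructor
  · rintro ⟨C, hC, hr, rfl, w, hw⟩
    rw [quotients_bot] at hC
    rcases Set.subset_singleton_iff_eq.1 hC with rfl | rfl
    · exact ((mem_atomicIntersection.1 hw).1 ⊥ (by simp [quotients_bot])).elim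
    · rw [Set.encard_singleton] at hr
      exact ⟨by exact_mod_cast hr.symm, h₁⟩
  · rintro ⟨rfl, rfl⟩
    exact ⟨{⊥}, quotients_bot.ge, by simp, h₁.symm, [], trivial⟩

theorem theorem1 :
    -- Upper bounds, for every regular language with `n` quotients, over any alphabet.
    (∀ (α : Type*) (L : Language α) (n : ℕ), L.IsRegular → quotientComplexity L = n →
      (∀ A, IsAtomWith L 0 A ∨ IsAtomWith L n A →
        quotientComplexity A ≤ ((2 ^ n - 1 : ℕ) : ℕ∞)) ∧
      (∀ r A, 1 ≤ r → r ≤ n - 1 → IsAtomWith L r A →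
        quotientComplexity A ≤ (atomBound n r : ℕ∞))) ∧
    -- The case `n = 1`: all words, and no words.
    (∀ α : Type*,
      (quotientComplexity (⊤ : Language α) = 1 ∧
        ∀ r A, IsAtomWith (⊤ : Language α) r A ↔ r = 0 ∧ A = ⊤) ∧
      (quotientComplexity (⊥ : Language α) = 1 ∧
        ∀ r A, IsAtomWith (⊥ : Language α) r A ↔ r = 1 ∧ A = ⊤)) ∧
    -- Tightness, for the witness languages.
    (∀ (n : ℕ) (hn : 2 ≤ n),
      quotientComplexity (witnessLanguage n hn) = n ∧
      (∀ C ⊆ quotients (witnessLanguage n hn),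
        ∃ w, w ∈ atomicIntersection (witnessLanguage n hn) C) ∧
      (∀ A, IsAtomWith (witnessLanguage n hn) 0 A ∨ IsAtomWith (witnessLanguage n hn) n A →
        quotientComplexity A = ((2 ^ n - 1 : ℕ) : ℕ∞)) ∧
      (∀ r A, 1 ≤ r → r ≤ n - 1 → IsAtomWith (witnessLanguage n hn) r A →
        quotientComplexity A = (atomBound n r : ℕ∞))) := by
  refine ⟨fun α L n _ h => ?_, fun α => ⟨⟨?_, fun r A => isAtomWith_top⟩,
    ⟨?_, fun r A => isAtomWith_bot⟩⟩, fun n hn => ?_⟩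
  · obtain ⟨Q, hQ, rfl⟩ := exists_finset_eq_quotients h
    exact ⟨fun A hA => quotientComplexity_le_of_isAtomWith_zero_or_card hQ hA,
      fun r A hr₁ hr₂ hA => quotientComplexity_le_of_isAtomWith hQ hr₁ (by omega) hA⟩
  · rw [quotientComplexity, quotients_top, Set.encard_singleton]
  · rw [quotientComplexity, quotients_bot, Set.encard_singleton]
  · have hcard := quotientComplexity_witnessLanguage hn
    have hL := hasAllTransformations_witnessLanguage hn
    obtain ⟨K₀, h₀, K₁, h₁, hn₀, hn₁⟩ := exists_quotients_witnessLanguage hn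
    refine ⟨hcard, fun C hC => hL.exists_mem_atomicIntersection h₀ h₁ hn₀ hn₁ hC, ?_⟩
    obtain ⟨Q, hQ, hQn⟩ := exists_finset_eq_quotients hcard
    generalize witnessLanguage n hn = L at *
    subst hQn
    exact ⟨fun A hA => hL.quotientComplexity_eq_of_isAtomWith_zero_or_card hQ h₀ h₁ hn₀ hn₁ hA,
      fun r A hr₁ hr₂ hA => hL.quotientComplexity_eq_of_isAtomWith hQ h₀ h₁ hn₀ hn₁ hr₁
        (by omega) hA⟩
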